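/- Let $n\ge 1$. Let $V=\mathbb{C}^{2n|1}$ have the basis $u_1,\dots,u_{2n}$ (even), $u_{2n+1}$ (odd), with the even, non-degenerate, $(-1)$-supersymmetric bilinear form $B$ given by $B(u_i,u_{2n+1-i})=-B(u_{2n+1-i},u_i)=1$ for $1\le i\le n$, $B(u_{2n+1},u_{2n+1})=1$, and all other values on basis vectors equal to $0$. Let $\mathfrak{spo}(2n|1)=\mathfrak{spo}(V,B)\subseteq\mathfrak{gl}(2n|1)$ be the corresponding orthosymplectic Lie superalgebra. Let $\mathfrak{t}=\bigoplus_{i=1}^n\mathbb{C}(E_{i,i}-E_{2n+1-i,2n+1-i})$, and let $\mathfrak{b}=\mathfrak{t}\oplus\mathfrak{n}^+$ be the Borel subalgebra for which $\mathfrak{n}^+_{\bar 0}$ consists of the strictly upper triangular matrices in $\mathfrak{sp}(2n)=\mathfrak{spo}(2n|1)_{\bar 0}$ and $\mathfrak{n}^+_{\bar 1}=\bigoplus_{k=1}^n\mathbb{C}(E_{k,2n+1}+E_{2n+1,2n+1-k})$. A weight $\lambda\in\mathfrak{t}^*$ is written $\lambda=(\lambda_1,\dots,\lambda_n)\in\mathbb{C}^n$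 with $\lambda_i=\lambda(E_{i,i}-E_{2n+1-i,2n+1-i})$. Let $E=V\otimes\mathbb{C}^{1|1}$, and let $\mathfrak{spo}(2n|1)$ act by superderivations on the supersymmetric algebra $S(E)=\mathrm{Sym}(E_{\bar 0})\otimes\Lambda(E_{\bar 1})$, extending the action $X(u\otimes e)=X(u)\otimes e$ on $E$. Let $M$ be an irreducible ($\mathbb{Z}/2$-graded) representation of $\mathfrak{spo}(2n|1)$ of highest weight $\lambda$ with respect to $\mathfrak{b}$ (that is, there is a non-zero $v\in M$ with $\mathfrak{n}^+v=0$ and $Hv=\lambda(H)v$ for all $H\in\mathfrak{t}$), and suppose that there is a non-zero homogeneous (even or odd) homomorphism of $\mathfrak{spo}(2n|1)$-modules $M\to S(E)$. Then either $\lambda=(0,\dots,0)$, or $$\lambda=(a,\underbrace{1,\dots,1}_{k},\underbrace{0,\dots,0}_{n-k-1})$$ for some integers $a\ge 1$ and $0\le k\le n-1$. -/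

import Mathlib

open scoped TensorProduct

universe u

namespace OrthoSymplectic

/-- Parity of the basis vector `u_{i+1}` of `V = ℂ^{2n|1}`: the first `2n` are even,
the last one is odd. -/
def par (n : ℕ) (i : Fin (2 * n + 1)) : ZMod 2 := if i.val < 2 * n then 0 else 1

/-- The sign `(-1)^p`. -/
def sgn (p : ZMod 2) : ℂ := if p = 0 then 1 else -1

/-- The complex `(2n+1) × (2n+1)` matrices, acting on `V` by `X u_j = ∑ i, X i j • u_i`. -/
abbrev Mat (n : ℕ) : Type := Matrix (Fin (2 * n + 1)) (Fin (2 * n + 1)) ℂ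

/-- Gram matrix of the form `B` on `V = ℂ^{2n|1}`: `B(u_i, u_{2n+1-i}) = 1` and
`B(u_{2n+1-i}, u_i) = -1` for `1 ≤ i ≤ n`, and `B(u_{2n+1}, u_{2n+1}) = 1`
(rows and columns are numbered from `0` here). -/
def form (n : ℕ) : Mat n := fun i j =>
  if i.val + j.val + 1 = 2 * n then (if i.val < n then 1 else -1)
  else if i.val = 2 * n ∧ j.val = 2 * n then 1 else 0

theorem sgn_mul_self (p : ZMod 2) : sgn p * sgn p = 1 := by
  unfold sgn; split_ifs <;> norm_num

theorem sgn_add (p q : ZMod 2) : sgn (p + q) = sgn p * sgn q := by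
  have h : ∀ p : ZMod 2, p = 0 ∨ p = 1 := by decide
  have h2 : (1 + 1 : ZMod 2) = 0 := by decide
  rcases h p with rfl | rfl <;> rcases h q with rfl | rfl <;> simp [sgn, h2]

theorem zmod_aux : ∀ a b c : ZMod 2, a + b = a + c + (c + b) := by decide

theorem zmod_aux' : ∀ a b c : ZMod 2, a + b = c + b + (a + c) := by decide

theorem zmod_aux'' : ∀ p a b : ZMod 2, p * a = p * (a + b) + p * b := by decide

/-- The homogeneous component of parity `p` of `𝔰𝔭𝔬(2n|1) = 𝔰𝔭𝔬(V, B)`: the matrices `X`,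
homogeneous of parity `p`, such that `B(X u_i, u_j) + (-1)^{p |u_i|} B(u_i, X u_j) = 0`
for all `i`, `j`. -/
def spo (n : ℕ) (p : ZMod 2) : Submodule ℂ (Mat n) where
  carrier := {X | (∀ i j, par n i + par n j ≠ p → X i j = 0) ∧
    ∀ i j, (X.transpose * form n) i j + sgn (p * par n i) * (form n * X) i j = 0}
  zero_mem' := by simp
  add_mem' := by
    rintro X Y ⟨h1, h2⟩ ⟨h3, h4⟩
    refine ⟨fun i j h => by simp [h1 i j h, h3 i j h], fun i j => ?_⟩
    have := h2 i j
    have := h4 i j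
    simp only [Matrix.transpose_add, Matrix.add_mul, Matrix.mul_add, Matrix.add_apply]
    linear_combination h2 i j + h4 i j
  smul_mem' := by
    rintro c X ⟨h1, h2⟩
    refine ⟨fun i j h => by simp [h1 i j h], fun i j => ?_⟩
    simp only [Matrix.transpose_smul, Matrix.smul_mul, Matrix.mul_smul, Matrix.smul_apply,
      smul_eq_mul]
    linear_combination c * h2 i j

theorem spo_mul_form {n : ℕ} {p q : ZMod 2} (X : spo n p) (Y : spo n q) (i j : Fin (2 * n + 1)) :
    (((X : Mat n) * (Y : Mat n)).transpose * form n) i j =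
      sgn (p * q) * sgn ((p + q) * par n i) *
        (form n * ((Y : Mat n) * (X : Mat n))) i j := by
  obtain ⟨X, hX1, hX2⟩ := X
  obtain ⟨Y, hY1, hY2⟩ := Y
  simp only
  have hX : ∀ k j, (X.transpose * form n) k j = - (sgn (p * par n k) * (form n * X) k j) :=
    fun k j => by linear_combination hX2 k j
  have hY : ∀ k j, (Y.transpose * form n) k j = - (sgn (q * par n k) * (form n * Y) k j) :=
    fun k j => by linear_combination hY2 k j
  have key : ∀ k, Y k i * sgn (p * par n k) = sgn (p * q) * sgn (p * par n i) * Y k i := by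
    intro k
    by_cases h : par n k + par n i = q
    · have : p * par n k = p * q + p * par n i := by
        rw [← h]
        exact zmod_aux'' _ _ _
      rw [this, sgn_add]; ring
    · simp [hY1 k i h]
  rw [Matrix.transpose_mul, Matrix.mul_assoc, Matrix.mul_apply]
  simp only [Matrix.transpose_apply, hX]
  have : ∀ k, Y k i * -(sgn (p * par n k) * (form n * X) k j) =
      - (sgn (p * q) * sgn (p * par n i)) * (Y.transpose i k * (form n * X) k j) := by
    intro k
    rw [Matrix.transpose_apply]
    linear_combination (-(form n * X) k j) * key k
  simp only [this]
  rw [← Finset.mul_sum, ← Matrix.mul_apply, ← Matrix.mul_assoc, Matrix.mul_apply]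
  simp only [hY]
  rw [← Matrix.mul_assoc, Matrix.mul_apply (M := form n * Y), Finset.mul_sum, Finset.mul_sum]
  refine Finset.sum_congr rfl fun k _ => ?_
  rw [add_mul, sgn_add]
  ring

/-- The superbracket `[X, Y] = X Y - (-1)^{|X||Y|} Y X` of homogeneous elements of
`𝔰𝔭𝔬(2n|1)`. -/
def bracket {n : ℕ} {p q : ZMod 2} (X : spo n p) (Y : spo n q) : spo n (p + q) :=
  ⟨(X : Mat n) * (Y : Mat n)
      - sgn (p * q) • ((Y : Mat n) * (X : Mat n)), by
    constructor
    · intro i j h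
      have h1 : ∀ k, X.1 i k * Y.1 k j = 0 := fun k => by
        by_cases h1 : par n i + par n k = p
        · have : par n k + par n j ≠ q := by
            intro h2; apply h; rw [← h1, ← h2]; exact zmod_aux _ _ _
          rw [Y.2.1 _ _ this, mul_zero]
        · rw [X.2.1 _ _ h1, zero_mul]
      have h2 : ∀ k, Y.1 i k * X.1 k j = 0 := fun k => by
        by_cases h1 : par n i + par n k = q
        · have : par n k + par n j ≠ p := by
            intro h2; apply h; rw [← h1, ← h2]; exact zmod_aux' _ _ _
          rw [X.2.1 _ _ this, mul_zero]
        · rw [Y.2.1 _ _ h1, zero_mul]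
      simp [Matrix.mul_apply, h1, h2]
    · intro i j
      have h1 := spo_mul_form X Y i j
      have h2 := spo_mul_form Y X i j
      simp only [Matrix.transpose_sub, Matrix.transpose_smul, Matrix.sub_mul, Matrix.mul_sub,
        Matrix.smul_mul, Matrix.mul_smul, Matrix.sub_apply, Matrix.smul_apply, smul_eq_mul]
      rw [h1, h2, mul_comm q p, add_comm q p]
      linear_combination (-(sgn ((p + q) * par n i) * (form n * (X.1 * Y.1)) i j)) *
        sgn_mul_self (p * q)⟩

/-- A representation of the Lie superalgebra `𝔰𝔭𝔬(2n|1)` on the vector space `M`. -/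
structure SpoRep (n : ℕ) (M : Type u) [AddCommGroup M] [Module ℂ M] where
  grading : ZMod 2 → Submodule ℂ M
  isInternal : DirectSum.IsInternal grading
  act : ∀ p, spo n p →ₗ[ℂ] Module.End ℂ M
  act_mem : ∀ (p q : ZMod 2) (X : spo n p), ∀ m ∈ grading q, act p X m ∈ grading (p + q)
  act_bracket : ∀ (p q : ZMod 2) (X : spo n p) (Y : spo n q),
    act (p + q) (bracket X Y) = act p X * act q Y - sgn (p * q) • (act q Y * act p X)

namespace SpoRep

variable {n : ℕ} {M N : Type*} [AddCommGroup M] [Module ℂ M] [AddCommGroup N] [Module ℂ N]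

/-- `M` is non-zero and its only `ℤ/2`-graded invariant subspaces are `0` and `M`. -/
def IsIrreducible (π : SpoRep n M) : Prop :=
  Nontrivial M ∧ ∀ W : Submodule ℂ M, W ≤ (⨆ p, W ⊓ π.grading p) →
    (∀ (p : ZMod 2) (X : spo n p), ∀ m ∈ W, π.act p X m ∈ W) → W = ⊥ ∨ W = ⊤

/-- `v` is a highest weight vector of weight `lam` for the Borel subalgebra `𝔟^{spo}`.
The Cartan subalgebra consists of the diagonal matrices in `𝔰𝔭𝔬(2n|1)`, and
`lam i` is the value of the weight at `E_{i,i} - E_{2n+1-i,2n+1-i}`; the even part of the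
nilradical consists of the strictly upper triangular matrices in `𝔰𝔭(2n)`, and its odd part is
spanned by the `E_{k,2n+1} + E_{2n+1,2n+1-k}`, `1 ≤ k ≤ n`. -/
structure IsHighestWeightVector (π : SpoRep n M) (lam : Fin n → ℂ) (v : M) : Prop where
  ne_zero : v ≠ 0
  cartan : ∀ X : spo n 0, (X : Mat n).IsDiag →
    π.act 0 X v = (∑ i : Fin n, lam i * X.1 ⟨i.val, by omega⟩ ⟨i.val, by omega⟩) • v
  nil_even : ∀ X : spo n 0, (∀ i j, j ≤ i → X.1 i j = 0) → π.act 0 X v = 0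
  nil_odd : ∀ X : spo n 1,
    X.1 ∈ Submodule.span ℂ (Set.range fun k : Fin n =>
      Matrix.single (⟨k.val, by omega⟩ : Fin (2 * n + 1)) (Fin.last (2 * n)) (1 : ℂ)
        + Matrix.single (Fin.last (2 * n)) (⟨2 * n - 1 - k.val, by omega⟩ : Fin (2 * n + 1)) 1) →
    π.act 1 X v = 0

/-- `T` is a homomorphism of representations, homogeneous of parity `r`. -/
structure IsHom (π : SpoRep n M) (ρ : SpoRep n N) (r : ZMod 2) (T : M →ₗ[ℂ] N) : Prop where
  map_mem : ∀ q, ∀ m ∈ π.grading q, T m ∈ ρ.grading (r + q)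
  map_act : ∀ (p : ZMod 2) (X : spo n p) (m : M),
    T (π.act p X m) = sgn (r * p) • ρ.act p X (T m)

end SpoRep

/-- The supersymmetric algebra `S(E) = Sym(E_0) ⊗ Λ(E_1)` of `E = ℂ^{2n|1} ⊗ ℂ^{1|1}`, where
`E_0` has the basis `x_1, …, x_{2n+1}` and `E_1` has the basis `η_1, …, η_{2n+1}`. If `v, w` are
the even and the odd basis vector of `ℂ^{1|1}`, then `x_i = u_i ⊗ v` and `η_i = u_i ⊗ w` for
`i ≤ 2n`, and `x_{2n+1} = u_{2n+1} ⊗ w`, `η_{2n+1} = u_{2n+1} ⊗ v`. -/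
abbrev SE (n : ℕ) : Type :=
  MvPolynomial (Fin (2 * n + 1)) ℂ ⊗[ℂ] ExteriorAlgebra ℂ (Fin (2 * n + 1) → ℂ)

noncomputable section

/-- Multiplication by `x_i` on `S(E)`. -/
def mulX (n : ℕ) (i : Fin (2 * n + 1)) : Module.End ℂ (SE n) :=
  TensorProduct.map (LinearMap.mulLeft ℂ (MvPolynomial.X i)) LinearMap.id

/-- The derivation `∂/∂x_i` of `S(E)`. -/
def derX (n : ℕ) (i : Fin (2 * n + 1)) : Module.End ℂ (SE n) :=
  TensorProduct.map (MvPolynomial.pderiv i).toLinearMap LinearMap.id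

/-- Multiplication by `η_i` on `S(E)`. -/
def mulEta (n : ℕ) (i : Fin (2 * n + 1)) : Module.End ℂ (SE n) :=
  TensorProduct.map LinearMap.id (LinearMap.mulLeft ℂ (ExteriorAlgebra.ι ℂ (Pi.single i 1)))

/-- The odd (left) superderivation `∂/∂η_i` of `S(E)`. -/
def derEta (n : ℕ) (i : Fin (2 * n + 1)) : Module.End ℂ (SE n) :=
  TensorProduct.map LinearMap.id
    (CliffordAlgebra.contractLeft (Q := (0 : QuadraticForm ℂ (Fin (2 * n + 1) → ℂ)))
      (LinearMap.proj i))

/-- Multiplication on `S(E)` by `u_i ⊗ e`, where `e` is the basis vector of parity `s` of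
`ℂ^{1|1}`. -/
def mulE (n : ℕ) (i : Fin (2 * n + 1)) (s : ZMod 2) : Module.End ℂ (SE n) :=
  if par n i + s = 0 then mulX n i else mulEta n i

/-- The superderivation of `S(E)` dual to `u_i ⊗ e`, where `e` is the basis vector of parity `s`
of `ℂ^{1|1}`. -/
def derE (n : ℕ) (i : Fin (2 * n + 1)) (s : ZMod 2) : Module.End ℂ (SE n) :=
  if par n i + s = 0 then derX n i else derEta n i

/-- The superderivation of `S(E)` that extends the action `u_j ⊗ e ↦ u_i ⊗ e` on `E` of the
matrix unit `E_{i,j}`. -/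
def eps (n : ℕ) (i j : Fin (2 * n + 1)) : Module.End ℂ (SE n) :=
  ∑ s : ZMod 2, mulE n i s * derE n j s

/-- The action on `S(E)` of a matrix in `𝔤𝔩(2n|1)`. -/
def glAct (n : ℕ) :
    Mat n →ₗ[ℂ] Module.End ℂ (SE n) where
  toFun X := ∑ i, ∑ j, X i j • eps n i j
  map_add' X Y := by simp [add_smul, Finset.sum_add_distrib]
  map_smul' c X := by simp [Finset.smul_sum, smul_smul]

/-- The `ℤ/2`-grading of `S(E)`: the parity of the number of factors `η_i`. -/
def gradingSE (n : ℕ) (p : ZMod 2) : Submodule ℂ (SE n) :=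
  LinearMap.range (LinearMap.lTensor (MvPolynomial (Fin (2 * n + 1)) ℂ)
    (CliffordAlgebra.evenOdd (0 : QuadraticForm ℂ (Fin (2 * n + 1) → ℂ)) p).subtype)

theorem zmod_cases : ∀ p : ZMod 2, p = 0 ∨ p = 1 := by decide

theorem add_self_zmod : ∀ p : ZMod 2, p + p = 0 := by decide

/-- The parity involution of `S(E)`. -/
def parityOp (n : ℕ) : Module.End ℂ (SE n) :=
  TensorProduct.map LinearMap.id
    (CliffordAlgebra.involute (Q := (0 : QuadraticForm ℂ (Fin (2 * n + 1) → ℂ)))).toLinearMap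

theorem parityOp_of_mem {n : ℕ} {p : ZMod 2} {m : SE n} (hm : m ∈ gradingSE n p) :
    parityOp n m = sgn p • m := by
  obtain ⟨y, rfl⟩ := hm
  induction y with
  | zero => simp
  | add a b ha hb => simp only [map_add, ha, hb, smul_add]
  | tmul f x =>
    obtain ⟨x, hx⟩ := x
    rcases zmod_cases p with rfl | rfl
    · simp [parityOp, sgn, CliffordAlgebra.involute_eq_of_mem_even hx]
    · have h := CliffordAlgebra.involute_eq_of_mem_odd hx
      change f ⊗ₜ[ℂ] (CliffordAlgebra.involute x) = sgn 1 • (f ⊗ₜ[ℂ] x)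
      rw [h, sgn, if_neg one_ne_zero, ← TensorProduct.tmul_smul]
      exact congrArg _ (neg_one_smul ℂ x).symm

theorem gradingSE_codisjoint {n : ℕ} (m : SE n) :
    ∃ a ∈ gradingSE n 0, ∃ b ∈ gradingSE n 1, a + b = m := by
  rw [← Submodule.mem_sup]
  induction m using TensorProduct.induction_on with
  | zero => exact zero_mem _
  | add a b ha hb => exact add_mem ha hb
  | tmul f x =>
    have hx : x ∈ CliffordAlgebra.evenOdd (0 : QuadraticForm ℂ (Fin (2 * n + 1) → ℂ)) 0 ⊔
        CliffordAlgebra.evenOdd (0 : QuadraticForm ℂ (Fin (2 * n + 1) → ℂ)) 1 := by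
      rw [(CliffordAlgebra.evenOdd_isCompl _).sup_eq_top]; trivial
    obtain ⟨a, ha, b, hb, rfl⟩ := Submodule.mem_sup.1 hx
    rw [TensorProduct.tmul_add]
    exact add_mem (Submodule.mem_sup_left ⟨f ⊗ₜ ⟨a, ha⟩, rfl⟩)
      (Submodule.mem_sup_right ⟨f ⊗ₜ ⟨b, hb⟩, rfl⟩)

theorem mem_gradingSE {n : ℕ} {p : ZMod 2} {m : SE n} :
    m ∈ gradingSE n p ↔ parityOp n m = sgn p • m := by
  refine ⟨parityOp_of_mem, fun h => ?_⟩
  obtain ⟨a, ha, b, hb, rfl⟩ := gradingSE_codisjoint m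
  rw [map_add, parityOp_of_mem ha, parityOp_of_mem hb] at h
  rcases zmod_cases p with rfl | rfl
  · have hb0 : b = 0 := by
      have h2 : (2 : ℂ) • b = 0 := by
        simp only [sgn, if_true, one_ne_zero, if_false] at h
        linear_combination (norm := module) -h
      simpa using h2
    simpa [hb0] using ha
  · have ha0 : a = 0 := by
      have h2 : (2 : ℂ) • a = 0 := by
        simp only [sgn, if_true, one_ne_zero, if_false] at h
        linear_combination (norm := module) h
      simpa using h2
    simpa [ha0] using hb

theorem gradingSE_isInternal (n : ℕ) : DirectSum.IsInternal (gradingSE n) := by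
  rw [DirectSum.isInternal_submodule_iff_isCompl (i := (0 : ZMod 2)) (j := 1) _ (by decide)
    (by ext p; simpa using zmod_cases p)]
  constructor
  · rw [Submodule.disjoint_def]
    intro m h0 h1
    have h := (parityOp_of_mem h0).symm.trans (parityOp_of_mem h1)
    have h2 : (2 : ℂ) • m = 0 := by
      simp only [sgn, if_true, one_ne_zero, if_false] at h
      linear_combination (norm := module) h
    simpa using h2
  · rw [codisjoint_iff, eq_top_iff]
    intro m _
    exact Submodule.mem_sup.2 (gradingSE_codisjoint m)

/-- The parity of `u_i ⊗ e`, with `e` of parity `s`, governs how multiplications and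
superderivations commute with the parity involution. -/
theorem mulE_parity (n : ℕ) (i : Fin (2 * n + 1)) (s : ZMod 2) :
    parityOp n * mulE n i s = sgn (par n i + s) • (mulE n i s * parityOp n) := by
  unfold mulE
  split_ifs with h
  · apply TensorProduct.ext'
    intro f x
    simp [parityOp, mulX, h, sgn]
  · have h1 : par n i + s = 1 := (zmod_cases _).resolve_left h
    apply TensorProduct.ext'
    intro f x
    simp [parityOp, mulEta, h1, sgn, ExteriorAlgebra.ι, TensorProduct.tmul_neg]

theorem contract_involute {n : ℕ} (d : Module.Dual ℂ (Fin (2 * n + 1) → ℂ))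
    (x : CliffordAlgebra (0 : QuadraticForm ℂ (Fin (2 * n + 1) → ℂ))) :
    CliffordAlgebra.involute (CliffordAlgebra.contractLeft d x) =
      - CliffordAlgebra.contractLeft d (CliffordAlgebra.involute x) := by
  induction x using CliffordAlgebra.left_induction with
  | algebraMap r => simp
  | add x y hx hy => simp only [map_add, hx, hy, neg_add]
  | ι_mul x m hx =>
    rw [CliffordAlgebra.contractLeft_ι_mul, map_mul, CliffordAlgebra.involute_ι, neg_mul, map_neg,
      CliffordAlgebra.contractLeft_ι_mul, map_sub, map_mul, CliffordAlgebra.involute_ι, hx]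
    simp

theorem derE_parity (n : ℕ) (i : Fin (2 * n + 1)) (s : ZMod 2) :
    parityOp n * derE n i s = sgn (par n i + s) • (derE n i s * parityOp n) := by
  unfold derE
  split_ifs with h
  · apply TensorProduct.ext'
    intro f x
    simp [parityOp, derX, h, sgn]
  · have h1 : par n i + s = 1 := (zmod_cases _).resolve_left h
    apply TensorProduct.ext'
    intro f x
    simp [parityOp, derEta, h1, sgn, TensorProduct.tmul_neg, contract_involute]

theorem eps_parity (n : ℕ) (i j : Fin (2 * n + 1)) :
    parityOp n * eps n i j = sgn (par n i + par n j) • (eps n i j * parityOp n) := by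
  unfold eps
  rw [Finset.mul_sum, Finset.sum_mul, Finset.smul_sum]
  refine Finset.sum_congr rfl fun s _ => ?_
  rw [← mul_assoc, mulE_parity, smul_mul_assoc, mul_assoc, derE_parity, mul_smul_comm, smul_smul,
    ← sgn_add, ← mul_assoc]
  congr 2
  generalize par n i = a
  generalize par n j = b
  revert s a b; decide

theorem mulE_mulE (n : ℕ) (i j : Fin (2 * n + 1)) (s t : ZMod 2) :
    mulE n i s * mulE n j t =
      sgn ((par n i + s) * (par n j + t)) • (mulE n j t * mulE n i s) := by
  unfold mulE
  split_ifs with h1 h2 h2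
  · apply TensorProduct.ext'
    intro f x
    simp [mulX, h1, sgn, mul_left_comm]
  · apply TensorProduct.ext'
    intro f x
    simp [mulX, mulEta, h1, sgn]
  · apply TensorProduct.ext'
    intro f x
    simp [mulX, mulEta, h2, sgn]
  · have h1 := (zmod_cases _).resolve_left h1
    have h2 := (zmod_cases _).resolve_left h2
    apply TensorProduct.ext'
    intro f x
    have h := ExteriorAlgebra.ι_add_mul_swap (R := ℂ)
      (Pi.single i 1 : Fin (2 * n + 1) → ℂ) (Pi.single j 1)
    have h := congrArg (· * x) (eq_neg_of_add_eq_zero_left h)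
    simp only [mul_assoc, neg_mul] at h
    simp [mulEta, h1, h2, sgn, h, TensorProduct.tmul_neg]

theorem pderiv_comm' {n : ℕ} (i j : Fin (2 * n + 1)) (f : MvPolynomial (Fin (2 * n + 1)) ℂ) :
    MvPolynomial.pderiv i (MvPolynomial.pderiv j f) =
      MvPolynomial.pderiv j (MvPolynomial.pderiv i f) := by
  let D : Fin (2 * n + 1) → Derivation ℂ (MvPolynomial (Fin (2 * n + 1)) ℂ)
    (MvPolynomial (Fin (2 * n + 1)) ℂ) := fun k => MvPolynomial.pderiv k
  have h : ⁅D i, D j⁆ = 0 := by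
    apply MvPolynomial.derivation_ext
    intro k
    simp only [D, Derivation.commutator_apply, MvPolynomial.pderiv_X, Pi.single_apply]
    split_ifs <;> simp
  have h2 : ⁅D i, D j⁆ f = 0 := by
    rw [h, Derivation.zero_apply]
  rw [Derivation.commutator_apply] at h2
  exact sub_eq_zero.1 h2

theorem derE_derE (n : ℕ) (i j : Fin (2 * n + 1)) (s t : ZMod 2) :
    derE n i s * derE n j t =
      sgn ((par n i + s) * (par n j + t)) • (derE n j t * derE n i s) := by
  unfold derE
  split_ifs with h1 h2 h2
  · apply TensorProduct.ext'
    intro f x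
    simp [derX, h1, sgn, pderiv_comm' i j f]
  · apply TensorProduct.ext'
    intro f x
    simp [derX, derEta, h1, sgn]
  · apply TensorProduct.ext'
    intro f x
    simp [derX, derEta, h2, sgn]
  · have h1 := (zmod_cases _).resolve_left h1
    have h2 := (zmod_cases _).resolve_left h2
    apply TensorProduct.ext'
    intro f x
    have h := CliffordAlgebra.contractLeft_comm (Q := (0 : QuadraticForm ℂ (Fin (2 * n + 1) → ℂ)))
      (d := LinearMap.proj i) (d' := LinearMap.proj j) x
    simp [derEta, h1, h2, sgn, h, TensorProduct.tmul_neg]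

/-- The canonical (anti)commutation relations. -/
theorem derE_mulE (n : ℕ) (j k : Fin (2 * n + 1)) (s t : ZMod 2) :
    derE n j s * mulE n k t =
      sgn ((par n j + s) * (par n k + t)) • (mulE n k t * derE n j s) +
        (if j = k ∧ s = t then 1 else 0) := by
  have hcan : j = k → (j = k ∧ s = t ↔ par n j + s = par n k + t) := by
    rintro rfl; simp
  unfold derE mulE
  split_ifs with h1 h2 h3 h3 h2 h3 h3
  · obtain ⟨rfl, rfl⟩ := h3
    apply TensorProduct.ext'
    intro f x
    simp [derX, mulX, h1, sgn, TensorProduct.add_tmul]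
  · have h4 : j ≠ k := fun h => h3 ((hcan h).2 (h1.trans h2.symm))
    apply TensorProduct.ext'
    intro f x
    simp [derX, mulX, h1, sgn, MvPolynomial.pderiv_X_of_ne (Ne.symm h4)]
  · obtain ⟨rfl, rfl⟩ := h3; exact absurd h1 h2
  · apply TensorProduct.ext'
    intro f x
    simp [derX, mulEta, h1, sgn]
  · obtain ⟨rfl, rfl⟩ := h3; exact absurd h2 h1
  · apply TensorProduct.ext'
    intro f x
    simp [derEta, mulX, h2, sgn]
  · have h5 := (zmod_cases _).resolve_left h1
    obtain ⟨rfl, rfl⟩ := h3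
    apply TensorProduct.ext'
    intro f x
    simp [derEta, mulEta, h5, sgn, ExteriorAlgebra.ι, CliffordAlgebra.contractLeft_ι_mul,
      TensorProduct.tmul_sub]
    abel
  · have h5 := (zmod_cases _).resolve_left h1
    have h6 := (zmod_cases _).resolve_left h2
    have h4 : j ≠ k := fun h => h3 ((hcan h).2 (h5.trans h6.symm))
    apply TensorProduct.ext'
    intro f x
    simp [derEta, mulEta, h5, h6, sgn, ExteriorAlgebra.ι, CliffordAlgebra.contractLeft_ι_mul,
      TensorProduct.tmul_neg, h4]

theorem quad_aux {R : Type*} [Ring R] [Algebra ℂ R] (A B C D u v : R) (a b c d e : ℂ)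
    (e1 : B * C = a • (C * B) + u) (e2 : D * A = b • (A * D) + v)
    (e3 : A * C = c • (C * A)) (e4 : B * D = d • (D * B)) (he : e * b = a * c * d) :
    (A * B) * (C * D) = e • ((C * D) * (A * B)) + A * u * D - e • (C * v * B) := by
  have l1 : A * B * (C * D) = a • (A * C * (B * D)) + A * u * D := by
    have : A * B * (C * D) = A * (B * C) * D := by simp only [mul_assoc]
    rw [this, e1, mul_add, add_mul]
    simp only [mul_smul_comm, smul_mul_assoc, mul_assoc]
  have l2 : C * D * (A * B) = b • (C * A * (D * B)) + C * v * B := by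
    have : C * D * (A * B) = C * (D * A) * B := by simp only [mul_assoc]
    rw [this, e2, mul_add, add_mul]
    simp only [mul_smul_comm, smul_mul_assoc, mul_assoc]
  rw [l1, l2, e3, e4, smul_add, smul_smul, he, smul_mul_assoc, mul_smul_comm, smul_smul,
    smul_smul]
  rw [mul_assoc a c d]
  abel

theorem zmod_aux₃ : ∀ s t a b c d : ZMod 2, (a + b) * (c + d) + (d + t) * (a + s) =
    (b + s) * (c + t) + (a + s) * (c + t) + (b + s) * (d + t) := by decide

theorem sum_aux {R : Type*} [Ring R] [Algebra ℂ R] (f g : ZMod 2 → R) (f' g' : ZMod 2 → R)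
    (e : ℂ) (P Q : Prop) [Decidable P] [Decidable Q]
    (h : ∀ s t, (f s * g s) * (f' t * g' t) = e • ((f' t * g' t) * (f s * g s)) +
      f s * (if P ∧ s = t then 1 else 0) * g' t - e • (f' t * (if Q ∧ t = s then 1 else 0) * g s)) :
    (∑ s, f s * g s) * (∑ t, f' t * g' t) -
        e • ((∑ t, f' t * g' t) * (∑ s, f s * g s)) =
      (if P then ∑ s, f s * g' s else 0) - e • (if Q then ∑ s, f' s * g s else 0) := by
  have h1 : ∀ s t, (f s * g s) * (f' t * g' t) - e • ((f' t * g' t) * (f s * g s)) =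
      f s * (if P ∧ s = t then 1 else 0) * g' t -
        e • (f' t * (if Q ∧ t = s then 1 else 0) * g s) := by
    intro s t; rw [h]; abel
  rw [Finset.sum_mul_sum, Finset.sum_mul_sum, Finset.sum_comm (f := fun t s =>
    f' t * g' t * (f s * g s)), Finset.smul_sum]
  simp only [Finset.smul_sum, ← Finset.sum_sub_distrib, h1]
  simp only [Finset.sum_sub_distrib, ← Finset.smul_sum]
  congr 1
  · by_cases hP : P <;> simp [hP]
  · congr 1
    by_cases hQ : Q <;> simp [hQ]

theorem eps_bracket (n : ℕ) (i j k l : Fin (2 * n + 1)) :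
    eps n i j * eps n k l -
        sgn ((par n i + par n j) * (par n k + par n l)) • (eps n k l * eps n i j) =
      (if j = k then eps n i l else 0) -
        sgn ((par n i + par n j) * (par n k + par n l)) • (if l = i then eps n k j else 0) := by
  refine sum_aux (mulE n i) (derE n j) (mulE n k) (derE n l) _ (j = k) (l = i) fun s t => ?_
  refine quad_aux _ _ _ _ _ _ _ _ _ _ _ (derE_mulE n j k s t) (derE_mulE n l i t s)
    (mulE_mulE n i k s t) (derE_derE n j l s t) ?_
  rw [← sgn_add, ← sgn_add, ← sgn_add, zmod_aux₃ s t]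

theorem bracket_aux {R ι : Type*} [Ring R] [Algebra ℂ R] [Fintype ι] [DecidableEq ι]
    (E : ι → ι → R) (X Y : Matrix ι ι ℂ) (c : ℂ)
    (h : ∀ i j k l, (X i j * Y k l) • (E i j * E k l - c • (E k l * E i j)) =
      (X i j * Y k l) • ((if j = k then E i l else 0) - c • (if l = i then E k j else 0))) :
    ∑ i, ∑ j, (X * Y - c • (Y * X)) i j • E i j =
      (∑ i, ∑ j, X i j • E i j) * (∑ i, ∑ j, Y i j • E i j) -
        c • ((∑ i, ∑ j, Y i j • E i j) * (∑ i, ∑ j, X i j • E i j)) := by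
  have key : ∀ Z W : Matrix ι ι ℂ, ∑ i, ∑ j, (Z * W) i j • E i j =
      ∑ a : ι × ι, ∑ b : ι × ι, (Z a.1 a.2 * W b.1 b.2) •
        (if a.2 = b.1 then E a.1 b.2 else 0) := by
    intro Z W
    simp only [Fintype.sum_prod_type, Matrix.mul_apply, Finset.sum_smul]
    refine Finset.sum_congr rfl fun i _ => ?_
    rw [Finset.sum_comm]
    refine Finset.sum_congr rfl fun j _ => ?_
    rw [Finset.sum_comm]
    refine Finset.sum_congr rfl fun l _ => ?_
    simp
  have hprod : ∀ Z W : Matrix ι ι ℂ, (∑ i, ∑ j, Z i j • E i j) * (∑ i, ∑ j, W i j • E i j) =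
      ∑ a : ι × ι, ∑ b : ι × ι, (Z a.1 a.2 * W b.1 b.2) • (E a.1 a.2 * E b.1 b.2) := by
    intro Z W
    simp only [← Fintype.sum_prod_type']
    rw [Finset.sum_mul_sum]
    simp only [smul_mul_smul_comm, Fintype.sum_prod_type]
  have hl : ∑ i, ∑ j, (X * Y - c • (Y * X)) i j • E i j =
      (∑ i, ∑ j, (X * Y) i j • E i j) - c • ∑ i, ∑ j, (Y * X) i j • E i j := by
    simp only [Matrix.sub_apply, Matrix.smul_apply, sub_smul, Finset.sum_sub_distrib,
      Finset.smul_sum, smul_assoc]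
  rw [hl, key, key Y X, hprod, hprod Y X, Finset.sum_comm (f := fun a b : ι × ι =>
    (Y a.1 a.2 * X b.1 b.2) • (if a.2 = b.1 then E a.1 b.2 else 0)),
    Finset.sum_comm (f := fun a b : ι × ι =>
    (Y a.1 a.2 * X b.1 b.2) • (E a.1 a.2 * E b.1 b.2))]
  simp only [Finset.smul_sum, ← Finset.sum_sub_distrib]
  refine Finset.sum_congr rfl fun a _ => Finset.sum_congr rfl fun b _ => ?_
  have := h a.1 a.2 b.1 b.2
  rw [mul_comm (Y b.1 b.2), smul_comm c, smul_comm c, ← smul_sub, ← smul_sub, this]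

theorem glAct_bracket {n : ℕ} (p q : ZMod 2) (X : spo n p) (Y : spo n q) :
    glAct n (bracket X Y).1 =
      glAct n X.1 * glAct n Y.1 - sgn (p * q) • (glAct n Y.1 * glAct n X.1) := by
  refine bracket_aux (eps n) X.1 Y.1 (sgn (p * q)) fun i j k l => ?_
  by_cases h1 : par n i + par n j = p
  · by_cases h2 : par n k + par n l = q
    · have h := eps_bracket n i j k l
      rw [h1, h2] at h
      rw [h]
    · simp only [Y.2.1 k l h2, mul_zero, zero_smul]
  · simp only [X.2.1 i j h1, zero_mul, zero_smul]

theorem glAct_mem {n : ℕ} (p q : ZMod 2) (X : spo n p) (m : SE n) (hm : m ∈ gradingSE n q) :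
    glAct n X.1 m ∈ gradingSE n (p + q) := by
  rw [glAct]
  simp only [LinearMap.coe_mk, AddHom.coe_mk, LinearMap.sum_apply, LinearMap.smul_apply]
  refine Submodule.sum_mem _ fun i _ => Submodule.sum_mem _ fun j _ => ?_
  by_cases h : par n i + par n j = p
  · refine Submodule.smul_mem _ _ ?_
    rw [mem_gradingSE, ← h, sgn_add]
    have := congrArg (fun T => T m) (eps_parity n i j)
    simp only [Module.End.mul_apply, LinearMap.smul_apply] at this
    rw [this, parityOp_of_mem hm, map_smul, smul_smul]
  · rw [X.2.1 i j h, zero_smul]; exact zero_mem _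

/-- The representation of `𝔰𝔭𝔬(2n|1)` on the supersymmetric algebra `S(E)` of
`E = ℂ^{2n|1} ⊗ ℂ^{1|1}`: the extension by superderivations of `X (u ⊗ e) = X u ⊗ e`. -/
def repSE (n : ℕ) : SpoRep n (SE n) where
  grading := gradingSE n
  isInternal := gradingSE_isInternal n
  act p := (glAct n).comp (spo n p).subtype
  act_mem := glAct_mem
  act_bracket := glAct_bracket

end

end OrthoSymplectic

/-! By a Schur argument `T` is injective, so `T v` is a non-zero vector of `S(E)` of weight `lam`,
annihilated by the strictly upper triangular part of `𝔰𝔭(2n)`. It remains to bound the weights of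
such singular vectors (`IsSingular`). In the variables other than `x_{2n+1}`, `η_{2n+1}`, which
`𝔰𝔭(2n)` leaves alone, `S(E)` is polynomials in `2n` bosons `x_j` tensored with an exterior algebra
in `2n` fermions `η_j`.

Integrality and dominance come from `sl₂`-theory: off-diagonal matrix units act locally nilpotently,
so the long roots make each `lam i` a natural number and the short roots make the sequence
decreasing (`exists_nat`, `exists_nat_sub`).

The hook shape comes from one row of bosons. Let `D = ∂/∂x_1` and let `M` be maximal with `D^M w ≠
0`. Applying `D^(M+1)` to the equations `X w = 0`, for the root vectors `X` in the first row, shows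
that `D^M w` is annihilated by `∂/∂x_j` for every `1 < j ≤ 2n` (`exists_derE_eq_zero`). For `i > 1`
the `i`-th Cartan element commutes with `D`, so `D^M w` still has weight `lam i`; but there only the
fermions contribute, through a difference of two commuting idempotents. Hence `lam i ∈ {-1, 0, 1}`
(`cube_eq`), and by integrality it is `0` or `1`. -/

namespace OrthoSymplectic

open Matrix

/-! ### Generalities on endomorphisms -/

section Generalities

variable {K W : Type*} [Field K] [AddCommGroup W] [Module K W]

/-- Every vector is killed by some power of `f`. -/
def IsLocallyNilpotent (f : Module.End K W) : Prop := ∀ w, ∃ N : ℕ, (f ^ N) w = 0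

theorem pow_apply_eq_zero_of_le {f : Module.End K W} {w : W} {N k : ℕ} (h : (f ^ N) w = 0)
    (hk : N ≤ k) : (f ^ k) w = 0 := by
  obtain ⟨m, rfl⟩ := Nat.exists_eq_add_of_le' hk
  rw [pow_add, Module.End.mul_apply, h, map_zero]

theorem IsLocallyNilpotent.of_isNilpotent {f : Module.End K W} (h : IsNilpotent f) :
    IsLocallyNilpotent f := by
  obtain ⟨N, hN⟩ := h
  exact fun w => ⟨N, by rw [hN, LinearMap.zero_apply]⟩

theorem IsLocallyNilpotent.smul {f : Module.End K W} (hf : IsLocallyNilpotent f) (c : K) :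
    IsLocallyNilpotent (c • f) := fun w => by
  obtain ⟨N, hN⟩ := hf w
  exact ⟨N, by rw [smul_pow, LinearMap.smul_apply, hN, smul_zero]⟩

theorem IsLocallyNilpotent.mul_of_commute {f g : Module.End K W} (hg : IsLocallyNilpotent g)
    (h : Commute f g) : IsLocallyNilpotent (f * g) := fun w => by
  obtain ⟨N, hN⟩ := hg w
  exact ⟨N, by rw [h.mul_pow, Module.End.mul_apply, hN, map_zero]⟩

theorem IsLocallyNilpotent.add_of_commute {f g : Module.End K W} (hf : IsLocallyNilpotent f)
    (hg : IsLocallyNilpotent g) (h : Commute f g) : IsLocallyNilpotent (f + g) := fun w => by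
  obtain ⟨N, hN⟩ := hf w
  obtain ⟨L, hL⟩ := hg w
  refine ⟨N + L, ?_⟩
  rw [h.add_pow, LinearMap.sum_apply]
  refine Finset.sum_eq_zero fun k _ => ?_
  rw [(Nat.cast_commute _ _).eq.symm, Module.End.mul_apply]
  suffices (f ^ k * g ^ (N + L - k)) w = 0 by rw [this, map_zero]
  -- In each binomial term either the exponent of `f` is at least `N` or that of `g` is at least
  -- `L`.
  rcases le_or_gt N k with hk | hk
  · rw [(h.pow_pow _ _).eq, Module.End.mul_apply, pow_apply_eq_zero_of_le hN hk, map_zero]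
  · rw [Module.End.mul_apply, pow_apply_eq_zero_of_le hL (by omega), map_zero]

theorem exists_last_pow_apply_ne_zero {f : Module.End K W} (hf : IsLocallyNilpotent f) {w : W}
    (hw : w ≠ 0) : ∃ k : ℕ, (f ^ k) w ≠ 0 ∧ (f ^ (k + 1)) w = 0 :=
  Nat.exists_not_and_succ_of_not_zero_of_exists (p := fun k => (f ^ k) w = 0) hw (hf w)

/-- A weight vector killed by `e`, for an `sl₂`-triple with `f` locally nilpotent, has a natural
number as weight. -/
theorem exists_nat_of_primitive [CharZero K] {h e f : Module.End K W} (hef : e * f - f * e = h)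
    (hhf : h * f - f * h = -(2 : K) • f) (hf : IsLocallyNilpotent f) {w : W} (hw : w ≠ 0)
    {c : K} (he : e w = 0) (hh : h w = c • w) : ∃ m : ℕ, c = m := by
  obtain ⟨k, hk, hk1⟩ := exists_last_pow_apply_ne_zero hf hw
  have hef' : ∀ x, e (f x) = f (e x) + h x := fun x => by
    rw [← hef]; simp
  have hhf' : ∀ x, h (f x) = f (h x) - (2 : K) • f x := fun x => by
    have := LinearMap.congr_fun hhf x
    simp only [LinearMap.sub_apply, Module.End.mul_apply, LinearMap.smul_apply] at this
    linear_combination (norm := module) this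
  have h1 : ∀ j : ℕ, h ((f ^ j) w) = (c - 2 * j) • (f ^ j) w := by
    intro j
    induction j with
    | zero => simpa using hh
    | succ j ih =>
      rw [pow_succ', Module.End.mul_apply, hhf', ih, map_smul]
      push_cast
      module
  -- At the end `j = k` of the string the left side vanishes while `f ^ k w` does not, which forces
  -- `c = k`. Local nilpotency of `f` replaces finite dimension.
  have h2 : ∀ j : ℕ, e ((f ^ (j + 1)) w) = ((j + 1) * (c - j)) • (f ^ j) w := by
    intro j
    induction j with
    | zero => simp [hef', he, hh]
    | succ j ih =>
      rw [pow_succ' f (j + 1), Module.End.mul_apply, hef', ih, h1, map_smul,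
        ← Module.End.mul_apply, ← pow_succ']
      push_cast
      module
  have h3 := h2 k
  rw [hk1, map_zero, eq_comm, smul_eq_zero, or_iff_left hk] at h3
  rcases mul_eq_zero.1 h3 with h4 | h4
  · exact absurd h4 (Nat.cast_add_one_ne_zero k)
  · exact ⟨k, sub_eq_zero.1 h4⟩

theorem eq_zero_of_eq_neg_one_smul [CharZero K] {f : Module.End K W} (h : f = (-1 : K) • f) :
    f = 0 := by
  have : (2 : K) • f = 0 := by linear_combination (norm := module) h
  exact (smul_eq_zero.1 this).resolve_left two_ne_zero

/-- The Leibniz rule in the Weyl algebra. On a vector killed by `D ^ (k + 1)`, only the term with `D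
^ k` survives. -/
theorem pow_succ_mul_of_commutator {D x : Module.End K W} (h : D * x = x * D + 1) (k : ℕ) :
    D ^ (k + 1) * x = x * D ^ (k + 1) + ((k : K) + 1) • D ^ k := by
  induction k with
  | zero => simp [h]
  | succ k ih =>
    rw [pow_succ' D (k + 1), mul_assoc, ih, mul_add, ← mul_assoc, h, mul_smul_comm, ← pow_succ']
    push_cast
    rw [add_mul, mul_assoc, one_mul]
    module

end Generalities

/-! ### Canonical (anti)commutation relations in even coordinates -/

variable {n : ℕ}

theorem par_castSucc (i : Fin (2 * n)) : par n i.castSucc = 0 := by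
  simp [par]

theorem sgn_zero : sgn 0 = 1 := rfl

theorem sgn_one : sgn 1 = -1 := by simp [sgn]

theorem eps_eq (i j : Fin (2 * n + 1)) :
    eps n i j = mulE n i 0 * derE n j 0 + mulE n i 1 * derE n j 1 :=
  Fin.sum_univ_two (fun s : ZMod 2 => mulE n i s * derE n j s)

theorem eps_commutator (i j k l : Fin (2 * n)) :
    eps n i.castSucc j.castSucc * eps n k.castSucc l.castSucc -
        eps n k.castSucc l.castSucc * eps n i.castSucc j.castSucc =
      (if j = k then eps n i.castSucc l.castSucc else 0) -
        (if l = i then eps n k.castSucc j.castSucc else 0) := by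
  simpa [par_castSucc, sgn_zero] using eps_bracket n i.castSucc j.castSucc k.castSucc l.castSucc

theorem glAct_single (i j : Fin (2 * n + 1)) (c : ℂ) :
    glAct n (single i j c) = c • eps n i j := by
  simp [glAct, single_apply, ite_smul, ite_and]

/-! ### Local nilpotency of derivations and commutation of bosons with fermions. -/

theorem pderiv_pow_monomial {σ R : Type*} [CommRing R] (i : σ) (k : ℕ) :
    ∀ (s : σ →₀ ℕ) (a : R), s i < k →
      ((MvPolynomial.pderiv i).toLinearMap ^ k) (MvPolynomial.monomial s a) = 0 := by
  induction k with
  | zero => intro s a h; omega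
  | succ k ih =>
    intro s a h
    rw [pow_succ, Module.End.mul_apply, Derivation.coeFn_coe, MvPolynomial.pderiv_monomial]
    by_cases h0 : s i = 0
    · simp [h0]
    · refine ih _ _ ?_
      simp only [Finsupp.tsub_apply, Finsupp.single_eq_same]
      omega

theorem isLocallyNilpotent_pderiv {σ K : Type*} [Field K] (i : σ) :
    IsLocallyNilpotent (MvPolynomial.pderiv (R := K) i).toLinearMap := by
  intro f
  induction f using MvPolynomial.induction_on' with
  | monomial s a => exact ⟨s i + 1, pderiv_pow_monomial i _ s a (Nat.lt_succ_self _)⟩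
  | add a b ha hb =>
    obtain ⟨N, hN⟩ := ha
    obtain ⟨L, hL⟩ := hb
    exact ⟨max N L, by rw [map_add, pow_apply_eq_zero_of_le hN (le_max_left _ _),
      pow_apply_eq_zero_of_le hL (le_max_right _ _), add_zero]⟩

theorem isLocallyNilpotent_derX (i : Fin (2 * n + 1)) : IsLocallyNilpotent (derX n i) := by
  intro w
  induction w using TensorProduct.induction_on with
  | zero => exact ⟨0, map_zero _⟩
  | tmul f x =>
    obtain ⟨N, hN⟩ := isLocallyNilpotent_pderiv (K := ℂ) i f
    refine ⟨N, ?_⟩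
    rw [derX, TensorProduct.map_pow, TensorProduct.map_tmul, hN, TensorProduct.zero_tmul]
  | add a b ha hb =>
    obtain ⟨N, hN⟩ := ha
    obtain ⟨L, hL⟩ := hb
    exact ⟨max N L, by rw [map_add, pow_apply_eq_zero_of_le hN (le_max_left _ _),
      pow_apply_eq_zero_of_le hL (le_max_right _ _), add_zero]⟩

theorem isLocallyNilpotent_derE (i : Fin (2 * n)) : IsLocallyNilpotent (derE n i.castSucc 0) := by
  rw [derE, if_pos (by rw [par_castSucc, add_zero])]
  exact isLocallyNilpotent_derX _

theorem commute_bosonic {i : Fin (2 * n)} {j : Fin (2 * n + 1)} {s : ZMod 2}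
    (h : ¬ (i.castSucc = j ∧ 0 = s)) : Commute (derE n i.castSucc 0) (mulE n j s) := by
  have := derE_mulE n i.castSucc j 0 s
  rwa [if_neg h, par_castSucc, zero_add, zero_mul, sgn_zero, one_smul, add_zero] at this

theorem commute_derE_zero (i : Fin (2 * n)) (j : Fin (2 * n + 1)) (s : ZMod 2) :
    Commute (derE n i.castSucc 0) (derE n j s) := by
  have := derE_derE n i.castSucc j 0 s
  rwa [par_castSucc, add_zero, zero_mul, sgn_zero, one_smul] at this

/-- The only variables that `eps k l` multiplies by are `x_k` and `η_k`, and `∂/∂x_o` sees neither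
unless `k = o`. -/
theorem commute_derE_zero_eps {o k : Fin (2 * n)} (l : Fin (2 * n)) (h : k ≠ o) :
    Commute (derE n o.castSucc 0) (eps n k.castSucc l.castSucc) := by
  rw [eps_eq]
  exact ((commute_bosonic (by simpa using h.symm)).mul_right
    (commute_derE_zero _ _ _)).add_right
    ((commute_bosonic (by simp)).mul_right (commute_derE_zero _ _ _))

theorem derE_one_mul_self (i : Fin (2 * n)) : derE n i.castSucc 1 * derE n i.castSucc 1 = 0 := by
  have := derE_derE n i.castSucc i.castSucc 1 1
  rw [par_castSucc, zero_add, one_mul, sgn_one] at this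
  exact eq_zero_of_eq_neg_one_smul this

theorem derE_one_mul_mulE_one (i j : Fin (2 * n)) :
    derE n i.castSucc 1 * mulE n j.castSucc 1 =
      (-1 : ℂ) • (mulE n j.castSucc 1 * derE n i.castSucc 1) + if i = j then 1 else 0 := by
  have := derE_mulE n i.castSucc j.castSucc 1 1
  simpa [par_castSucc, sgn_one] using this

theorem derE_zero_mul_mulE_zero (i : Fin (2 * n)) :
    derE n i.castSucc 0 * mulE n i.castSucc 0 =
      mulE n i.castSucc 0 * derE n i.castSucc 0 + 1 := by
  have := derE_mulE n i.castSucc i.castSucc 0 0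
  simpa [par_castSucc, sgn_zero] using this

theorem mulE_one_derE_one_sq {i j : Fin (2 * n)} (h : i ≠ j) :
    (mulE n i.castSucc 1 * derE n j.castSucc 1) ^ 2 = 0 := by
  have h1 := derE_one_mul_mulE_one j i
  rw [if_neg h.symm, add_zero] at h1
  rw [sq, mul_assoc, ← mul_assoc (derE n j.castSucc 1), h1, smul_mul_assoc, mul_assoc,
    derE_one_mul_self, mul_zero, smul_zero, mul_zero]

theorem commute_boson_fermion (i j k l : Fin (2 * n)) :
    Commute (mulE n i.castSucc 0 * derE n j.castSucc 0)
      (mulE n k.castSucc 1 * derE n l.castSucc 1) := by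
  have hm : ∀ a b : Fin (2 * n), Commute (mulE n a.castSucc 0) (mulE n b.castSucc 1) := by
    intro a b
    have := mulE_mulE n a.castSucc b.castSucc 0 1
    rwa [par_castSucc, add_zero, zero_mul, sgn_zero, one_smul] at this
  have hd : ∀ a b : Fin (2 * n), Commute (mulE n a.castSucc 0) (derE n b.castSucc 1) := by
    intro a b
    have := derE_mulE n b.castSucc a.castSucc 1 0
    rw [par_castSucc, par_castSucc, add_zero, mul_zero, sgn_zero, one_smul, if_neg (by simp),
      add_zero] at this
    exact this.symm
  exact ((hm i k).mul_right (hd i l)).mul_left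
    ((commute_bosonic (by simp)).mul_right (commute_derE_zero _ _ _))

/-- The bosonic part `x_i ∂/∂x_j` lowers the degree in `x_j`, the fermionic part `η_i ∂/∂η_j` has
square zero, and the two parts commute. -/
theorem isLocallyNilpotent_eps {i j : Fin (2 * n)} (h : i ≠ j) :
    IsLocallyNilpotent (eps n i.castSucc j.castSucc) := by
  rw [eps_eq]
  refine IsLocallyNilpotent.add_of_commute ?_
    (.of_isNilpotent ⟨2, mulE_one_derE_one_sq h⟩) (commute_boson_fermion i j i j)
  refine (isLocallyNilpotent_derE j).mul_of_commute (commute_bosonic ?_).symm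
  simpa using h.symm

/-! ### Root vectors of `𝔰𝔭(2n)` -/

/-- The sign `B(u_p, u_{2n+1-p})`. -/
def formSign (p : Fin (2 * n)) : ℂ := if p.val < n then 1 else -1

/-- The element of `𝔰𝔭(2n)` with entries at `(p, q)` and at its mirror image. -/
def rootMat (p q : Fin (2 * n)) : Mat n :=
  single p.castSucc q.castSucc 1 -
    single q.rev.castSucc p.rev.castSucc (formSign p * formSign q)

theorem form_castSucc_left (p : Fin (2 * n)) (i : Fin (2 * n + 1)) :
    form n p.castSucc i = if p.rev.castSucc = i then formSign p else 0 := by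
  simp only [form, formSign, Fin.ext_iff, Fin.val_castSucc, Fin.val_rev]
  split_ifs <;> first | rfl | omega

theorem form_castSucc_right (p : Fin (2 * n)) (i : Fin (2 * n + 1)) :
    form n i p.castSucc = if p.rev.castSucc = i then -formSign p else 0 := by
  simp only [form, formSign, Fin.ext_iff, Fin.val_castSucc, Fin.val_rev]
  split_ifs <;> first | rfl | omega | norm_num

theorem formSign_rev (p : Fin (2 * n)) : formSign p.rev = -formSign p := by
  simp only [formSign, Fin.val_rev]
  split_ifs <;> first | omega | norm_num

theorem formSign_mul_self (p : Fin (2 * n)) : formSign p * formSign p = 1 := by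
  simp only [formSign]
  split_ifs <;> norm_num

theorem single_transpose_mul_form (p q : Fin (2 * n)) (c : ℂ) :
    (single p.castSucc q.castSucc c).transpose * form n =
      single q.castSucc p.rev.castSucc (c * formSign p) := by
  ext i j
  rw [transpose_single, mul_apply, Finset.sum_eq_single p.castSucc, form_castSucc_left]
  · simp only [single_apply, and_true]
    by_cases h1 : q.castSucc = i <;> by_cases h2 : p.rev.castSucc = j <;> simp [h1, h2]
  · intro b _ hb
    simp [hb.symm]
  · simp

theorem form_mul_single (p q : Fin (2 * n)) (c : ℂ) :
    form n * single p.castSucc q.castSucc c =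
      single p.rev.castSucc q.castSucc (-(c * formSign p)) := by
  ext i j
  rw [mul_apply, Finset.sum_eq_single p.castSucc, form_castSucc_right]
  · simp only [single_apply, true_and]
    by_cases h1 : q.castSucc = j <;> by_cases h2 : p.rev.castSucc = i <;>
      simp [h1, h2, mul_comm]
  · intro b _ hb
    simp [hb.symm]
  · simp

/-- Transposing one matrix unit and multiplying its mirror image by the form give entries at the
same place. The sign in `rootMat` is the one that makes them cancel. -/
theorem rootMat_mem (p q : Fin (2 * n)) : rootMat p q ∈ spo n 0 := by
  constructor
  · intro i j h
    have h0 : ∀ (a b : Fin (2 * n)) (c : ℂ), single a.castSucc b.castSucc c i j = 0 := by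
      intro a b c
      refine single_apply_of_ne _ _ _ _ _ ?_
      rintro ⟨rfl, rfl⟩
      exact h (by simp [par_castSucc])
    simp [rootMat, h0]
  · intro i j
    rw [zero_mul, sgn_zero, one_mul, rootMat, transpose_sub, sub_mul, mul_sub,
      single_transpose_mul_form, single_transpose_mul_form, form_mul_single, form_mul_single,
      Fin.rev_rev, formSign_rev]
    have h1 : formSign p * formSign q * -formSign q = -formSign p := by
      linear_combination (-formSign p) * formSign_mul_self q
    rw [h1, Matrix.sub_apply, Matrix.sub_apply, one_mul, neg_neg]
    simp only [single_apply]
    split_ifs <;> ring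

theorem glAct_rootMat (p q : Fin (2 * n)) :
    glAct n (rootMat p q) = eps n p.castSucc q.castSucc -
      (formSign p * formSign q) • eps n q.rev.castSucc p.rev.castSucc := by
  rw [rootMat, map_sub, glAct_single, glAct_single, one_smul]

theorem rootMat_strictly_upper {p q : Fin (2 * n)} (h : p < q) (i j : Fin (2 * n + 1))
    (hij : j ≤ i) : rootMat p q i j = 0 := by
  rw [rootMat, Matrix.sub_apply, single_apply_of_ne, single_apply_of_ne, sub_zero]
  · rintro ⟨rfl, rfl⟩
    exact absurd hij (not_le.2 (Fin.castSucc_lt_castSucc_iff.2 (Fin.rev_lt_rev.2 h)))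
  · rintro ⟨rfl, rfl⟩
    exact absurd hij (not_le.2 (Fin.castSucc_lt_castSucc_iff.2 h))

/-- The index of `u_{i+1}`, for `i < n`. -/
def idx (i : Fin n) : Fin (2 * n) := ⟨i.val, by omega⟩

theorem formSign_idx (i : Fin n) : formSign (idx i) = 1 := by simp [formSign, idx]

theorem idx_ne_rev (i j : Fin n) : idx i ≠ (idx j).rev := by
  simp only [idx, ne_eq, Fin.ext_iff, Fin.val_rev]
  omega

theorem rootMat_idx_isDiag (i : Fin n) : (rootMat (idx i) (idx i)).IsDiag := by
  intro a b hab
  rw [rootMat, Matrix.sub_apply, single_apply_of_ne, single_apply_of_ne, sub_zero]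
  · rintro ⟨rfl, rfl⟩; exact hab rfl
  · rintro ⟨rfl, rfl⟩; exact hab rfl

theorem rootMat_idx_apply (i j : Fin n) :
    rootMat (idx i) (idx i) (idx j).castSucc (idx j).castSucc = if i = j then 1 else 0 := by
  have h : ¬ ((idx i).rev = idx j) := fun h => idx_ne_rev j i h.symm
  have h' : idx i = idx j ↔ i = j := by simp [idx, Fin.ext_iff]
  simp [rootMat, single_apply, h, h']

/-! ### `sl₂`-triples -/

section Relations

variable {K R ι : Type*} [Field K] [Ring R] [Algebra K R] [DecidableEq ι]

/-- The elements `E i j` satisfy the commutation relations of the matrix units of `𝔤𝔩`. -/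
def MatrixUnitRelations (E : ι → ι → R) : Prop :=
  ∀ i j k l, E i j * E k l - E k l * E i j =
    (if j = k then E i l else 0) - (if l = i then E k j else 0)

theorem sl2_relations_long {E : ι → ι → R} (hE : MatrixUnitRelations E) {i i' : ι} (h : i ≠ i') :
    E i i' * E i' i - E i' i * E i i' = E i i - E i' i' ∧
      (E i i - E i' i') * E i' i - E i' i * (E i i - E i' i') = -(2 : K) • E i' i := by
  constructor
  · rw [hE, if_pos rfl, if_pos rfl]
  · have e1 := hE i i i' i
    have e2 := hE i' i' i' i
    simp only [h, if_true, if_false] at e1 e2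
    simp only [sub_mul, mul_sub]
    linear_combination (norm := module) e1 - e2

/-- The triple of the root `ε_i - ε_j`, with `i'`, `j'` the mirror images of `i`, `j`. Both form
signs are `1` for `i, j ≤ n`, hence the minus signs on the mirror units. -/
theorem sl2_relations_short {E : ι → ι → R} (hE : MatrixUnitRelations E)
    {i j i' j' : ι} (hij : i ≠ j) (hii : i ≠ i') (hij' : i ≠ j')
    (hji' : j ≠ i') (hjj' : j ≠ j') (hij'' : i' ≠ j') :
    (E i j - E j' i') * (E j i + (-1 : K) • E i' j') -
        (E j i + (-1 : K) • E i' j') * (E i j - E j' i') =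
      (E i i - E i' i') - (E j j - E j' j') ∧
    ((E i i - E i' i') - (E j j - E j' j')) * (E j i + (-1 : K) • E i' j') -
        (E j i + (-1 : K) • E i' j') * ((E i i - E i' i') - (E j j - E j' j')) =
      -(2 : K) • (E j i + (-1 : K) • E i' j') := by
  constructor
  · have e1 := hE i j j i
    have e2 := hE i j i' j'
    have e3 := hE j' i' j i
    have e4 := hE j' i' i' j'
    simp only [hij', hji', hij'.symm, hji'.symm, if_true, if_false] at e1 e2 e3 e4
    simp only [sub_mul, mul_sub, add_mul, mul_add, smul_mul_assoc, mul_smul_comm]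
    linear_combination (norm := module) e1 - e2 - e3 + e4
  · have e1 := hE i i j i
    have e2 := hE i i i' j'
    have e3 := hE i' i' j i
    have e4 := hE i' i' i' j'
    have e5 := hE j j j i
    have e6 := hE j j i' j'
    have e7 := hE j' j' j i
    have e8 := hE j' j' i' j'
    simp only [hij, hii, hij', hji', hij'.symm, hji'.symm,
      hjj'.symm, hij''.symm, if_true, if_false] at e1 e2 e3 e4 e5 e6 e7 e8
    simp only [sub_mul, mul_sub, add_mul, mul_add, smul_mul_assoc, mul_smul_comm]
    linear_combination (norm := module) e1 - e2 - e3 + e4 - e5 + e6 + e7 - e8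

end Relations

section PrimitiveVectors

variable {K W ι : Type*} [Field K] [CharZero K] [AddCommGroup W] [Module K W] [DecidableEq ι]
  {E : ι → ι → Module.End K W}

theorem exists_nat_of_long_root (hE : MatrixUnitRelations E)
    (hnil : ∀ i j, i ≠ j → IsLocallyNilpotent (E i j)) {i i' : ι} (h : i ≠ i') {w : W}
    (hw : w ≠ 0) {c : K}
    (he : E i i' w = 0) (hh : (E i i - E i' i') w = c • w) : ∃ m : ℕ, c = m := by
  obtain ⟨r1, r2⟩ := sl2_relations_long (K := K) hE h
  exact exists_nat_of_primitive r1 r2 (hnil _ _ h.symm) hw he hh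

theorem exists_nat_of_short_root (hE : MatrixUnitRelations E)
    (hnil : ∀ i j, i ≠ j → IsLocallyNilpotent (E i j)) {i j i' j' : ι} (hij : i ≠ j)
    (hii : i ≠ i') (hij' : i ≠ j') (hji' : j ≠ i') (hjj' : j ≠ j') (hij'' : i' ≠ j') {w : W} (hw : w ≠ 0) {c : K}
    (he : (E i j - E j' i') w = 0)
    (hh : ((E i i - E i' i') - (E j j - E j' j')) w = c • w) : ∃ m : ℕ, c = m := by
  obtain ⟨r1, r2⟩ := sl2_relations_short (K := K) hE hij hii hij' hji' hjj' hij''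
  refine exists_nat_of_primitive r1 r2 ?_ hw he hh
  -- The two summands of the lowering operator commute, since their index pairs do not chain.
  refine (hnil _ _ hij.symm).add_of_commute ((hnil _ _ hij'').smul _) (Commute.smul_right ?_ _)
  have e := hE j i i' j'
  rw [if_neg hii, if_neg hjj'.symm, sub_zero] at e
  exact sub_eq_zero.1 e

end PrimitiveVectors

/-! ### Singular vectors of `𝔰𝔭(2n)` in `S(E)` -/

theorem matrixUnitRelations_eps :
    MatrixUnitRelations fun p q : Fin (2 * n) => eps n p.castSucc q.castSucc :=
  fun i j k l => eps_commutator i j k l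

/-- `w` is a highest weight vector of weight `lam` for `𝔰𝔭(2n)`. -/
structure IsSingular (lam : Fin n → ℂ) (w : SE n) : Prop where
  ne_zero : w ≠ 0
  weight : ∀ i, (eps n (idx i).castSucc (idx i).castSucc -
    eps n (idx i).rev.castSucc (idx i).rev.castSucc) w = lam i • w
  nil : ∀ p q : Fin (2 * n), p < q → (eps n p.castSucc q.castSucc -
      (formSign p * formSign q) • eps n q.rev.castSucc p.rev.castSucc) w = 0

namespace IsSingular

variable {lam : Fin n → ℂ} {w : SE n}

theorem exists_nat (hw : IsSingular lam w) (i : Fin n) : ∃ m : ℕ, lam i = m := by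
  refine exists_nat_of_long_root matrixUnitRelations_eps
    (fun _ _ => isLocallyNilpotent_eps) (idx_ne_rev i i) hw.ne_zero ?_ (hw.weight i)
  have h := hw.nil (idx i) (idx i).rev (by simp [idx, Fin.lt_def, Fin.val_rev]; omega)
  rw [formSign_rev, formSign_idx, Fin.rev_rev] at h
  -- For a long root the matrix unit is its own mirror image, with opposite form signs, so the root
  -- vector is twice a matrix unit.
  have h2 : (2 : ℂ) • (eps n (idx i).castSucc (idx i).rev.castSucc) w = 0 := by
    rw [← h, LinearMap.sub_apply, LinearMap.smul_apply]
    module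
  exact (smul_eq_zero.1 h2).resolve_left two_ne_zero

theorem exists_nat_sub (hw : IsSingular lam w) {i j : Fin n} (hij : i < j) :
    ∃ m : ℕ, lam i - lam j = m := by
  have h5 : idx i ≠ idx j := by simp only [idx, ne_eq, Fin.ext_iff]; omega
  have h6 : (idx i).rev ≠ (idx j).rev := fun h => h5 (Fin.rev_injective h)
  refine exists_nat_of_short_root matrixUnitRelations_eps
    (fun _ _ => isLocallyNilpotent_eps) h5 (idx_ne_rev i i) (idx_ne_rev i j) (idx_ne_rev j i)
    (idx_ne_rev j j) h6 hw.ne_zero ?_ ?_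
  · have h := hw.nil (idx i) (idx j) hij
    rwa [formSign_idx, formSign_idx, mul_one, one_smul] at h
  · rw [LinearMap.sub_apply, hw.weight, hw.weight, sub_smul]

/-- Up to the factor `M!`, the vector `D^M w` is the leading coefficient of `w` in `x_1`. The root
vectors of the first row contain `x_1 ∂/∂x_j`, which would raise the degree in `x_1` if this
coefficient depended on `x_j`. -/
theorem exists_derE_eq_zero (hn : 1 ≤ n) (hw : IsSingular lam w) :
    ∃ M : ℕ, (derE n (idx ⟨0, hn⟩).castSucc 0 ^ M) w ≠ 0 ∧ ∀ j : Fin (2 * n), j.val ≠ 0 →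
      derE n j.castSucc 0 ((derE n (idx ⟨0, hn⟩).castSucc 0 ^ M) w) = 0 := by
  set o : Fin (2 * n) := idx ⟨0, hn⟩ with ho
  set D := derE n o.castSucc 0 with hD
  obtain ⟨M, hM, hM1⟩ := exists_last_pow_apply_ne_zero (isLocallyNilpotent_derE o) hw.ne_zero
  refine ⟨M, hM, fun j hj => ?_⟩
  have hjo : j ≠ o := by
    rintro rfl; exact hj rfl
  have hcomm : ∀ k l : Fin (2 * n), k ≠ o → (D ^ (M + 1)) (eps n k.castSucc l.castSucc w) = 0 := by
    intro k l hk
    rw [← Module.End.mul_apply, ((commute_derE_zero_eps l hk).pow_left (M + 1)).eq,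
      Module.End.mul_apply, hM1, map_zero]
  -- The fermionic half of `eps o j` commutes with `D`, so `D^(M+1) w = 0` kills it; in the bosonic
  -- half only the commutator of `D^(M+1)` with `x_1` remains.
  have hmain : (D ^ (M + 1)) (eps n o.castSucc j.castSucc w) =
      ((M : ℂ) + 1) • derE n j.castSucc 0 ((D ^ M) w) := by
    have h1 := pow_succ_mul_of_commutator (derE_zero_mul_mulE_zero o) M
    have h2 : ∀ k, Commute (D ^ k) (derE n j.castSucc 0) := fun k =>
      (commute_derE_zero o j.castSucc 0).pow_left k
    have h3 : Commute (D ^ (M + 1)) (mulE n o.castSucc 1 * derE n j.castSucc 1) :=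
      (((commute_bosonic (by simp)).mul_right (commute_derE_zero _ _ _))).pow_left _
    rw [eps_eq, ← Module.End.mul_apply, mul_add, h3.eq, ← mul_assoc, h1, add_mul, mul_assoc,
      (h2 _).eq, smul_mul_assoc, (h2 _).eq]
    simp only [LinearMap.add_apply, LinearMap.smul_apply, Module.End.mul_apply]
    rw [hM1]
    simp
  have hX := congrArg (D ^ (M + 1)) (hw.nil o j (by
    rw [Fin.lt_def, ho]; exact Nat.pos_of_ne_zero hj))
  rw [LinearMap.sub_apply, LinearMap.smul_apply, map_sub, map_smul, map_zero] at hX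
  have hM0 : (M : ℂ) + 1 ≠ 0 := Nat.cast_add_one_ne_zero M
  -- If `j` mirrors the first index, both terms of the root vector are the same operator and add up
  -- to a factor `2`. Otherwise the mirror term commutes with `D` and drops out.
  by_cases hr : j.rev = o
  · have hr' : o.rev = j := by rw [← hr, Fin.rev_rev]
    have hs : formSign o * formSign j = -1 := by
      rw [← hr', formSign_rev, mul_neg, formSign_mul_self]
    rw [hr, hr', hs, hmain] at hX
    have h2 : (2 * ((M : ℂ) + 1)) • derE n j.castSucc 0 ((D ^ M) w) = 0 := by
      rw [← hX]; module
    exact (smul_eq_zero.1 h2).resolve_left (mul_ne_zero two_ne_zero hM0)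
  · rw [hcomm _ _ hr, smul_zero, sub_zero, hmain] at hX
    exact (smul_eq_zero.1 hX).resolve_left hM0

end IsSingular

/-! ### Fermionic number operators and the bound on the remaining weights. -/

theorem sub_pow_three_of_idempotent {R : Type*} [Ring R] {A B : R} (hA : A * A = A)
    (hB : B * B = B) (h : A * B = B * A) : (A - B) * ((A - B) * (A - B)) = A - B := by
  have h1 : A * (A * B) = A * B := by rw [← mul_assoc, hA]
  have h2 : B * (A * B) = A * B := by rw [h, ← mul_assoc, hB]
  simp only [sub_mul, mul_sub, ← h, hA, hB, h1, h2]
  abel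

/-- Since `A - B` is a root of `t³ - t`, so is each of its eigenvalues; no simultaneous
diagonalisation of `A` and `B` is needed. -/
theorem cube_eq_of_apply_eq_smul {K W : Type*} [Field K] [AddCommGroup W] [Module K W]
    {A B : Module.End K W} (hA : A * A = A) (hB : B * B = B) (h : A * B = B * A) {w : W}
    (hw : w ≠ 0) {c : K} (hc : (A - B) w = c • w) : c * (c * c) = c := by
  have h1 := LinearMap.congr_fun (sub_pow_three_of_idempotent hA hB h) w
  simp only [Module.End.mul_apply, hc, map_smul, smul_smul, mul_assoc] at h1
  exact smul_left_injective K hw h1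

theorem mulE_derE_one_idempotent (i : Fin (2 * n)) :
    mulE n i.castSucc 1 * derE n i.castSucc 1 * (mulE n i.castSucc 1 * derE n i.castSucc 1) =
      mulE n i.castSucc 1 * derE n i.castSucc 1 := by
  have h1 := derE_one_mul_mulE_one i i
  rw [if_pos rfl] at h1
  rw [mul_assoc, ← mul_assoc (derE n i.castSucc 1), h1, add_mul, smul_mul_assoc, mul_assoc,
    derE_one_mul_self, mul_zero, smul_zero, zero_add, one_mul]

theorem mulE_derE_one_comm {i j : Fin (2 * n)} (h : i ≠ j) :
    mulE n i.castSucc 1 * derE n i.castSucc 1 * (mulE n j.castSucc 1 * derE n j.castSucc 1) =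
      mulE n j.castSucc 1 * derE n j.castSucc 1 *
        (mulE n i.castSucc 1 * derE n i.castSucc 1) := by
  have h1 := derE_one_mul_mulE_one i j
  have h2 := derE_one_mul_mulE_one j i
  rw [if_neg h, add_zero] at h1
  rw [if_neg h.symm, add_zero] at h2
  have h3 := mulE_mulE n i.castSucc j.castSucc 1 1
  have h4 := derE_derE n i.castSucc j.castSucc 1 1
  rw [par_castSucc, par_castSucc, zero_add, one_mul, sgn_one] at h3 h4
  rw [mul_assoc, ← mul_assoc (derE n i.castSucc 1), h1, mul_assoc (mulE n j.castSucc 1),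
    ← mul_assoc (derE n j.castSucc 1), h2]
  simp only [smul_mul_assoc, mul_smul_comm]
  rw [mul_assoc, h4, ← mul_assoc, h3]
  simp only [smul_mul_assoc, mul_smul_comm, mul_assoc, smul_smul]
  norm_num

namespace IsSingular

variable {lam : Fin n → ℂ} {w : SE n}

theorem cube_eq (hw : IsSingular lam w) (i : Fin n) (hi : i.val ≠ 0) :
    lam i * (lam i * lam i) = lam i := by
  have hn : 1 ≤ n := by omega
  obtain ⟨M, hM, hder⟩ := hw.exists_derE_eq_zero hn
  set o : Fin (2 * n) := idx ⟨0, hn⟩ with ho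
  set D := derE n o.castSucc 0 with hD
  have hio : idx i ≠ o := by simpa [ho, idx, Fin.ext_iff] using hi
  have hro : (idx i).rev ≠ o := fun h => idx_ne_rev ⟨0, hn⟩ i h.symm
  -- Neither `idx i` nor its mirror is the first index, so `D^M` passes through the Cartan element.
  -- The bosonic parts then vanish by `hder`, leaving the difference of two fermionic number
  -- operators.
  have hwt := congrArg (D ^ M) (hw.weight i)
  rw [LinearMap.sub_apply, map_sub, map_smul, ← Module.End.mul_apply, ← Module.End.mul_apply,
    ((commute_derE_zero_eps _ hio).pow_left M).eq,
    ((commute_derE_zero_eps _ hro).pow_left M).eq, Module.End.mul_apply,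
    Module.End.mul_apply, eps_eq, eps_eq, LinearMap.add_apply, LinearMap.add_apply,
    Module.End.mul_apply (mulE n _ 0), Module.End.mul_apply (mulE n _ 0),
    hder _ (by simpa [idx] using hi),
    hder _ (by simp only [idx, Fin.val_rev]; omega), map_zero, map_zero, zero_add, zero_add,
    ← LinearMap.sub_apply] at hwt
  exact cube_eq_of_apply_eq_smul (mulE_derE_one_idempotent _) (mulE_derE_one_idempotent _)
    (mulE_derE_one_comm (idx_ne_rev i i)) hM hwt

theorem hook (hn : 1 ≤ n) (hw : IsSingular lam w) :
    lam = 0 ∨ ∃ a k : ℕ, 1 ≤ a ∧ k ≤ n - 1 ∧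
      ∀ i : Fin n, lam i = if i.val = 0 then (a : ℂ) else if i.val ≤ k then 1 else 0 := by
  choose m hm using hw.exists_nat
  have hanti : ∀ i j : Fin n, i < j → m j ≤ m i := by
    intro i j hij
    obtain ⟨d, hd⟩ := hw.exists_nat_sub hij
    rw [hm, hm, sub_eq_iff_eq_add] at hd
    have : m i = d + m j := by exact_mod_cast hd
    omega
  have hle : ∀ i : Fin n, i.val ≠ 0 → m i ≤ 1 := by
    intro i hi
    have h := hw.cube_eq i hi
    rw [hm] at h
    have h' : m i * (m i * m i) = m i := by exact_mod_cast h
    by_contra! h2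
    nlinarith [Nat.mul_le_mul h2.le h2.le]
  let o : Fin n := ⟨0, hn⟩
  have ho : ∀ i : Fin n, m i ≤ m o := by
    intro i
    rcases Nat.eq_zero_or_pos i.val with h | h
    · rw [show i = o from Fin.ext h]
    · exact hanti o i h
  rcases Nat.eq_zero_or_pos (m o) with h0 | h0
  · left
    funext i
    have := ho i
    rw [hm, show m i = 0 by omega]
    simp
  · right
    -- The greatest `k` with `P k` is the last position of an entry `1`. The disjunct `k = 0` covers
    -- the case of no entry `1` beyond the first place, whatever the value of `a`.
    let P : ℕ → Prop := fun k => k = 0 ∨ ∃ h : k < n, m ⟨k, h⟩ = 1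
    classical
    let k := Nat.findGreatest P (n - 1)
    have hk : k ≤ n - 1 := Nat.findGreatest_le _
    have hPk : P k := Nat.findGreatest_spec (P := P) (Nat.zero_le _) (Or.inl rfl)
    refine ⟨m o, k, h0, hk, fun i => ?_⟩
    rw [hm]
    split_ifs with h1 h2
    · rw [show i = o from Fin.ext h1]
    · have h3 := hle i h1
      have h4 : 1 ≤ m i := by
        rcases hPk with h | ⟨hkn, h⟩
        · omega
        · rcases h2.eq_or_lt with h5 | h5
          · rw [show i = ⟨k, hkn⟩ from Fin.ext h5, h]
          · exact h.symm.le.trans (hanti i ⟨k, hkn⟩ h5)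
      rw [show m i = 1 by omega, Nat.cast_one]
    · have h3 := hle i h1
      have h4 : m i ≠ 1 := fun h =>
        h2 (Nat.le_findGreatest (P := P) (by omega) (Or.inr ⟨i.isLt, h⟩))
      rw [show m i = 0 by omega, Nat.cast_zero]

end IsSingular

/-! ### Schur's lemma and the passage from `M` to `S(E)`. -/

namespace SpoRep

variable {M N : Type*} [AddCommGroup M] [Module ℂ M] [AddCommGroup N] [Module ℂ N]

/-- The homogeneous components of a vector in the kernel of a homogeneous homomorphism lie in
the kernel, so Schur's lemma applies. -/
theorem IsHom.ker_eq_bot {π : SpoRep n M} {ρ : SpoRep n N} {r : ZMod 2} {T : M →ₗ[ℂ] N}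
    (hπ : π.IsIrreducible) (hT : π.IsHom ρ r T) (hT0 : T ≠ 0) : LinearMap.ker T = ⊥ := by
  refine (hπ.2 (LinearMap.ker T) ?_ ?_).resolve_right fun h => hT0 (LinearMap.ker_eq_top.1 h)
  · intro m hm
    have huniv : (Set.univ : Set (ZMod 2)) = {0, 1} := by
      ext p; simpa using zmod_cases p
    have hM := (DirectSum.isInternal_submodule_iff_isCompl _ (zero_ne_one (α := ZMod 2))
      huniv).1 π.isInternal
    have hN := (DirectSum.isInternal_submodule_iff_isCompl _ (zero_ne_one (α := ZMod 2))
      huniv).1 ρ.isInternal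
    have hm' : m ∈ π.grading 0 ⊔ π.grading 1 := by rw [hM.sup_eq_top]; trivial
    obtain ⟨a, ha, b, hb, rfl⟩ := Submodule.mem_sup.1 hm'
    rw [LinearMap.mem_ker, map_add] at hm
    -- An odd `T` merely exchanges the two components, so `T a` and `T b = -T a` lie in disjoint
    -- components for either parity.
    have hdisj : Disjoint (ρ.grading (r + 0)) (ρ.grading (r + 1)) := by
      rcases zmod_cases r with rfl | rfl
      · exact hN.disjoint
      · exact hN.disjoint.symm
    have hTa : T a = 0 := by
      refine Submodule.disjoint_def.1 hdisj _ (hT.map_mem 0 a ha) ?_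
      rw [eq_neg_of_add_eq_zero_left hm]
      exact neg_mem (hT.map_mem 1 b hb)
    have hTb : T b = 0 := by rwa [hTa, zero_add] at hm
    exact add_mem (Submodule.mem_iSup_of_mem 0 ⟨hTa, ha⟩) (Submodule.mem_iSup_of_mem 1 ⟨hTb, hb⟩)
  · intro p X m hm
    rw [LinearMap.mem_ker] at hm ⊢
    rw [hT.map_act, hm, map_zero, smul_zero]

end SpoRep

/-- On even elements the sign in `map_act` is `1`, so `T` commutes with `𝔰𝔭(2n)` whatever its parity
and carries the highest weight conditions over to `T v`. Injectivity of `T` gives `T v ≠ 0`. -/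
theorem isSingular_of_isHom {M : Type*} [AddCommGroup M] [Module ℂ M] {π : SpoRep n M}
    (hπ : π.IsIrreducible) {lam : Fin n → ℂ} {v : M} (hv : π.IsHighestWeightVector lam v)
    {r : ZMod 2} {T : M →ₗ[ℂ] SE n} (hT : π.IsHom (repSE n) r T) (hT0 : T ≠ 0) :
    IsSingular lam (T v) := by
  have hact : ∀ X : spo n 0, glAct n X.1 (T v) = T (π.act 0 X v) := by
    intro X
    rw [hT.map_act, mul_zero, sgn_zero, one_smul]
    rfl
  refine ⟨fun h => hv.ne_zero ?_, fun i => ?_, fun p q hpq => ?_⟩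
  · have : v ∈ LinearMap.ker T := h
    rwa [hT.ker_eq_bot hπ hT0, Submodule.mem_bot] at this
  · have h := hact ⟨_, rootMat_mem (idx i) (idx i)⟩
    rw [hv.cartan _ (rootMat_idx_isDiag i), map_smul, glAct_rootMat, formSign_mul_self,
      one_smul] at h
    rw [h]
    congr 1
    rw [Finset.sum_eq_single i]
    · exact (congrArg (lam i * ·) (rootMat_idx_apply i i)).trans (by simp)
    · intro j _ hj
      exact (congrArg (lam j * ·) (rootMat_idx_apply i j)).trans (by simp [hj.symm])
    · simp
  · have h := hact ⟨_, rootMat_mem p q⟩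
    rwa [hv.nil_even _ (rootMat_strictly_upper hpq), map_zero, glAct_rootMat] at h

end OrthoSymplectic

theorem mainTheorem5 (n : ℕ) (hn : 1 ≤ n) {M : Type*} [AddCommGroup M] [Module ℂ M]
    (π : OrthoSymplectic.SpoRep n M) (hπ : π.IsIrreducible)
    (lam : Fin n → ℂ) (v : M) (hv : π.IsHighestWeightVector lam v)
    (r : ZMod 2) (T : M →ₗ[ℂ] OrthoSymplectic.SE n)
    (hT : π.IsHom (OrthoSymplectic.repSE n) r T) (hT0 : T ≠ 0) :
    lam = 0 ∨ ∃ a k : ℕ, 1 ≤ a ∧ k ≤ n - 1 ∧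
      ∀ i : Fin n, lam i = if i.val = 0 then (a : ℂ) else if i.val ≤ k then 1 else 0 :=
  (OrthoSymplectic.isSingular_of_isHom hπ hv hT hT0).hook hn
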